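/- Let $\mathscr{H}$ be a complex Hilbert space. For a compact operator $X$ on $\mathscr{H}$ let $s_1(X)\ge s_2(X)\ge\cdots\ge 0$ be its singular values, i.e. the eigenvalues of $|X|=(X^*X)^{1/2}$ repeated according to multiplicity. For $0<p<\infty$ put $\|X\|_p=\big(\sum_j s_j(X)^p\big)^{1/p}$, and let $\mathbb{B}_p(\mathscr{H})$ be the set of compact operators $X$ on $\mathscr{H}$ with $\|X\|_p<\infty$. Let $0<p<\infty$, let $s,t\ge 1$ be integers, and let $X_1,\ldots,X_s,Y_1,\ldots,Y_t\in\mathbb{B}_p(\mathscr{H})$ satisfy \[ \sum_{i=1}^s|X_i|^2=\sum_{j=1}^t|Y_j|^2 . \] If $p\ge 2$, then \[ s^{1-\frac p2}\sum_{j=1}^t\|Y_j\|_p^p\;\le\;\sum_{i=1}^s\|X_i\|_p^p\;\le\; t^{\frac p2-1}\sum_{j=1}^t\|Y_j\|_p^p . \] If $0<p\le 2$, then both inequalities are reversed: \[ t^{\frac p2-1}\sum_{j=1}^t\|Y_j\|_p^p\;\le\;\sum_{i=1}^s\|X_i\|_p^p\;\le\; s^{1-\frac p2}\sum_{j=1}^t\|Y_j\|_p^p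 . \] -/

import Mathlib

open scoped ENNReal

section Schatten

variable {H : Type*} [NormedAddCommGroup H] [InnerProductSpace ℂ H] [CompleteSpace H]

/-- For `σ > 0`: the number of times `σ` occurs among the singular values of the compact operator
`X` (the eigenvalues of `|X| = (X* X)^(1/2)`, repeated according to multiplicity), that is, the
dimension of the eigenspace of `X* X` for the eigenvalue `σ ^ 2`. -/
noncomputable def singularMultiplicity (X : H →L[ℂ] H) (σ : ℝ) : ℕ :=
  Module.finrank ℂ
    (Module.End.eigenspace ((ContinuousLinearMap.adjoint X * X : H →L[ℂ] H) : H →ₗ[ℂ] H)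
      ((σ ^ 2 : ℝ) : ℂ))

/-- The extended Schatten `p`-(quasi)norm `(∑ⱼ sⱼ(X) ^ p) ^ (1 / p) ∈ [0, ∞]` of a compact
operator `X`. The sum over the singular values with repetition is written as a sum over the
positive reals `σ`, each weighted by its multiplicity; zero singular values contribute nothing. -/
noncomputable def eSchattenNorm (p : ℝ) (X : H →L[ℂ] H) : ℝ≥0∞ :=
  (∑' σ : Set.Ioi (0 : ℝ),
    (singularMultiplicity X σ : ℝ≥0∞) * ENNReal.ofReal (σ : ℝ) ^ p) ^ (1 / p)

/-- The Schatten class `𝔹_p(H)`: compact operators `X` on `H` with `‖X‖_p < ∞`. -/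
structure MemSchatten (p : ℝ) (X : H →L[ℂ] H) : Prop where
  isCompactOperator : IsCompactOperator X
  eSchattenNorm_lt_top : eSchattenNorm p X < ∞

/-- The Schatten `p`-(quasi)norm `‖X‖_p` as a real number, for `X` in `𝔹_p(H)`. -/
noncomputable def schattenNorm (p : ℝ) (X : H →L[ℂ] H) : ℝ :=
  (eSchattenNorm p X).toReal

end Schatten

open scoped NNReal InnerProductSpace

open Module.End

open scoped ComplexOrder

/-! ### Jensen's inequality for countable sums with sub-probability weights -/

/-! Put q = p/2, T_i = X_i* X_i and A = ∑ T_i. Then ‖X_i‖_p^p = Tr T_i^q, and A is the same operator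
for both families, so it suffices to compare ∑ Tr T_i^q with Tr A^q. For q ≥ 1, ∑ Tr T_i^q ≤ Tr A^q
≤ n^(q-1) ∑ Tr T_i^q, with both signs reversed for q ≤ 1.

The bound with the constant (`tsum_rpow_le_card_mul`, `card_mul_le_tsum_rpow`) is the power mean
inequality for the diagonal entries in an eigenbasis of A, followed by Peierls' inequality for each
T_i.

The bound without a constant (`sum_tsum_rpow_le`, `le_sum_tsum_rpow`) is Jensen again: if T_i g = β
g with g a unit vector, then β is the combination of the eigenvalues α_l of A with weights α_l⁻¹ β
|⟨g, e_l⟩|². Their total is β⟨A⁻¹g, g⟩ ≤ 1, because β|g⟩⟨g| ≤ A. Summing over all (i, g) recovers Tr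
A^q. Working in [0, ∞] removes all summability questions. -/

theorem ENNReal.rpow_tsum_mul_le {ι : Type*} {w z : ι → ℝ≥0∞} {q : ℝ} (hq : 1 ≤ q)
    (hw : ∑' i, w i ≤ 1) : (∑' i, w i * z i) ^ q ≤ ∑' i, w i * z i ^ q := by
  have hq0 : 0 < q := by linarith
  rw [← ENNReal.le_rpow_inv_iff hq0, ENNReal.tsum_eq_iSup_sum]
  refine iSup_le fun s => (ENNReal.inner_le_weight_mul_Lp_of_nonneg s hq w z).trans ?_
  -- Total weight below 1 is enough: the missing mass can sit at the value 0, where the power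
  -- vanishes.
  have h1 : (∑ i ∈ s, w i) ^ (1 - q⁻¹) ≤ 1 :=
    ENNReal.rpow_le_one ((ENNReal.sum_le_tsum s).trans hw) (by
      have := inv_le_one_of_one_le₀ hq
      linarith)
  calc _ ≤ 1 * (∑ i ∈ s, w i * z i ^ q) ^ q⁻¹ := by gcongr
    _ ≤ _ := by
      rw [one_mul]
      exact ENNReal.rpow_le_rpow (ENNReal.sum_le_tsum s) (by positivity)

/-- The convex case with exponent q⁻¹, applied to z ^ q. -/
theorem ENNReal.tsum_mul_rpow_le {ι : Type*} {w z : ι → ℝ≥0∞} {q : ℝ} (hq0 : 0 < q) (hq : q ≤ 1)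
    (hw : ∑' i, w i ≤ 1) : ∑' i, w i * z i ^ q ≤ (∑' i, w i * z i) ^ q := by
  have h := ENNReal.rpow_tsum_mul_le (z := fun i => z i ^ q) ((one_le_inv₀ hq0).2 hq) hw
  simp only [ENNReal.rpow_rpow_inv hq0.ne'] at h
  rwa [← ENNReal.rpow_inv_le_iff hq0]

theorem ENNReal.card_rpow_mul_sum_rpow_le {ι : Type*} (s : Finset ι) (f : ι → ℝ≥0∞) {q : ℝ}
    (hq0 : 0 < q) (hq : q ≤ 1) :
    (s.card : ℝ≥0∞) ^ (q - 1) * ∑ i ∈ s, f i ^ q ≤ (∑ i ∈ s, f i) ^ q := by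
  obtain rfl | hs := s.eq_empty_or_nonempty
  · simp
  have hc0 : (s.card : ℝ≥0∞) ≠ 0 := by simpa using hs.ne_empty
  have hct : (s.card : ℝ≥0∞) ≠ ∞ := ENNReal.natCast_ne_top _
  have h := ENNReal.rpow_sum_le_const_mul_sum_rpow s (fun i => f i ^ q) ((one_le_inv₀ hq0).2 hq)
  simp only [ENNReal.rpow_rpow_inv hq0.ne'] at h
  have h2 := ENNReal.rpow_le_rpow h hq0.le
  rw [ENNReal.rpow_inv_rpow hq0.ne', ENNReal.mul_rpow_of_nonneg _ _ hq0.le, ← ENNReal.rpow_mul,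
    sub_mul, inv_mul_cancel₀ hq0.ne', one_mul] at h2
  calc _ ≤ (s.card : ℝ≥0∞) ^ (q - 1) * ((s.card : ℝ≥0∞) ^ (1 - q) * (∑ i ∈ s, f i) ^ q) := by
        gcongr
    _ = _ := by
      rw [← mul_assoc, ← ENNReal.rpow_add _ _ hc0 hct]
      simp

/-! ### Quadratic forms and eigenbases of positive operators -/

section Eigenbasis

variable {H : Type*} [NormedAddCommGroup H] [InnerProductSpace ℂ H]

theorem HilbertBasis.tsum_enorm_inner_sq {ι : Type*} (b : HilbertBasis ι ℂ H) (x : H) :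
    ∑' l, ‖⟪b l, x⟫_ℂ‖ₑ ^ 2 = ‖x‖ₑ ^ 2 := by
  have h := Complex.hasSum_re (b.hasSum_inner_mul_inner x x)
  have e : ∀ l, (⟪x, b l⟫_ℂ * ⟪b l, x⟫_ℂ).re = ‖⟪b l, x⟫_ℂ‖ ^ 2 := fun l => by
    rw [← inner_conj_symm x (b l), Complex.conj_mul']
    norm_cast
  simp only [e] at h
  rw [inner_self_eq_norm_sq_to_K] at h
  have hx : (((‖x‖ : ℝ) : ℂ) ^ 2).re = ‖x‖ ^ 2 := by norm_cast
  have h' : HasSum (fun l => ‖⟪b l, x⟫_ℂ‖ ^ 2) (‖x‖ ^ 2) := by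
    rw [← hx]; exact h
  have := ENNReal.ofReal_tsum_of_nonneg (fun l => by positivity) h'.summable
  rw [h'.tsum_eq] at this
  simp only [ENNReal.ofReal_pow (norm_nonneg _), ofReal_norm] at this
  exact this.symm

theorem HilbertBasis.tsum_enorm_inner_sq' {ι : Type*} (b : HilbertBasis ι ℂ H) (x : H) :
    ∑' l, ‖⟪x, b l⟫_ℂ‖ₑ ^ 2 = ‖x‖ₑ ^ 2 := by
  simp only [← ofReal_norm, norm_inner_symm x]
  simpa only [← ofReal_norm] using b.tsum_enorm_inner_sq x

theorem HilbertBasis.enorm_eq_one {ι : Type*} (b : HilbertBasis ι ℂ H) (l : ι) : ‖b l‖ₑ = 1 := by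
  rw [← ofReal_norm, b.orthonormal.1 l, ENNReal.ofReal_one]

/-- The value `⟨T x, x⟩` of the quadratic form of a positive operator, in `[0, ∞]`. -/
noncomputable def quadForm (T : H →L[ℂ] H) (x : H) : ℝ≥0∞ :=
  ENNReal.ofReal (T.reApplyInnerSelf x)

theorem quadForm_sum {ι : Type*} (s : Finset ι) {T : ι → H →L[ℂ] H}
    (hT : ∀ i, (T i).IsPositive) (x : H) :
    quadForm (∑ i ∈ s, T i) x = ∑ i ∈ s, quadForm (T i) x := by
  simp only [quadForm]
  rw [← ENNReal.ofReal_sum_of_nonneg (fun i _ => (hT i).2 x)]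
  simp [ContinuousLinearMap.reApplyInnerSelf_apply, sum_inner]

/-- `b` is a Hilbert basis of eigenvectors of `T`, with eigenvalues `a`. -/
def IsEigenbasis {ι : Type*} (T : H →L[ℂ] H) (b : HilbertBasis ι ℂ H) (a : ι → ℝ≥0) : Prop :=
  ∀ l, T (b l) = ((a l : ℝ) : ℂ) • b l

namespace IsEigenbasis

variable {ι : Type*} {T : H →L[ℂ] H} {b : HilbertBasis ι ℂ H} {a : ι → ℝ≥0}

theorem inner_apply (h : IsEigenbasis T b a) (hT : T.IsPositive) (l : ι) (x : H) :
    ⟪b l, T x⟫_ℂ = ((a l : ℝ) : ℂ) * ⟪b l, x⟫_ℂ := by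
  rw [← hT.inner_left_eq_inner_right, h l, inner_smul_left]
  simp

theorem quadForm_eq (h : IsEigenbasis T b a) (hT : T.IsPositive) (x : H) :
    quadForm T x = ∑' l, (a l : ℝ≥0∞) * ‖⟪b l, x⟫_ℂ‖ₑ ^ 2 := by
  have hs := Complex.hasSum_re (b.hasSum_inner_mul_inner (T x) x)
  have e : ∀ l, (⟪T x, b l⟫_ℂ * ⟪b l, x⟫_ℂ).re = a l * ‖⟪b l, x⟫_ℂ‖ ^ 2 := fun l => by
    rw [← inner_conj_symm (T x) (b l), h.inner_apply hT, map_mul, mul_assoc, Complex.conj_mul',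
      Complex.conj_ofReal]
    norm_cast
  simp only [e] at hs
  have := ENNReal.ofReal_tsum_of_nonneg (fun l => by positivity) hs.summable
  rw [hs.tsum_eq] at this
  simp only [ENNReal.ofReal_mul (NNReal.coe_nonneg _), ENNReal.ofReal_pow (norm_nonneg _),
    ofReal_norm, ENNReal.ofReal_coe_nnreal] at this
  exact this

theorem quadForm_self (h : IsEigenbasis T b a) (l : ι) : quadForm T (b l) = a l := by
  rw [quadForm, ContinuousLinearMap.reApplyInnerSelf_apply, h l, inner_smul_left,
    inner_self_eq_norm_sq_to_K, b.orthonormal.1 l]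
  simp

theorem mul_enorm_inner_le_quadForm (h : IsEigenbasis T b a) (hT : T.IsPositive) (l : ι) (x : H) :
    (a l : ℝ≥0∞) * ‖⟪b l, x⟫_ℂ‖ₑ ^ 2 ≤ quadForm T x := by
  rw [h.quadForm_eq hT]
  exact ENNReal.le_tsum l

/-- **Peierls' inequality**: diagonal entries of a positive operator, convex case. -/
theorem tsum_quadForm_rpow_le (h : IsEigenbasis T b a) (hT : T.IsPositive)
    {κ : Type*} (e : HilbertBasis κ ℂ H) {q : ℝ} (hq : 1 ≤ q) :
    ∑' k, quadForm T (e k) ^ q ≤ ∑' l, (a l : ℝ≥0∞) ^ q := by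
  calc ∑' k, quadForm T (e k) ^ q
      ≤ ∑' k, ∑' l, ‖⟪b l, e k⟫_ℂ‖ₑ ^ 2 * (a l : ℝ≥0∞) ^ q := by
        refine ENNReal.tsum_le_tsum fun k => ?_
        simp only [h.quadForm_eq hT, mul_comm (a _ : ℝ≥0∞)]
        refine ENNReal.rpow_tsum_mul_le hq ?_
        simp [b.tsum_enorm_inner_sq, e.enorm_eq_one]
    _ = _ := by
        rw [ENNReal.tsum_comm]
        refine tsum_congr fun l => ?_
        rw [ENNReal.tsum_mul_right, e.tsum_enorm_inner_sq', b.enorm_eq_one, one_pow, one_mul]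

/-- **Peierls' inequality**: diagonal entries of a positive operator, concave case. -/
theorem le_tsum_quadForm_rpow (h : IsEigenbasis T b a) (hT : T.IsPositive)
    {κ : Type*} (e : HilbertBasis κ ℂ H) {q : ℝ} (hq0 : 0 < q) (hq : q ≤ 1) :
    ∑' l, (a l : ℝ≥0∞) ^ q ≤ ∑' k, quadForm T (e k) ^ q := by
  calc ∑' l, (a l : ℝ≥0∞) ^ q = ∑' k, ∑' l, ‖⟪b l, e k⟫_ℂ‖ₑ ^ 2 * (a l : ℝ≥0∞) ^ q := by
        rw [ENNReal.tsum_comm]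
        refine tsum_congr fun l => ?_
        rw [ENNReal.tsum_mul_right, e.tsum_enorm_inner_sq', b.enorm_eq_one, one_pow, one_mul]
    _ ≤ _ := by
        refine ENNReal.tsum_le_tsum fun k => ?_
        simp only [h.quadForm_eq hT, mul_comm (a _ : ℝ≥0∞)]
        refine ENNReal.tsum_mul_rpow_le hq0 hq ?_
        simp [b.tsum_enorm_inner_sq, e.enorm_eq_one]

/-- If `β |g⟩⟨g| ≤ T`, then `β ⟨T⁻¹ g, g⟩ ≤ 1`. -/
theorem tsum_inv_mul_le_one (h : IsEigenbasis T b a) (g : H) (β : ℝ≥0)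
    (hg : ∀ x, (β : ℝ≥0∞) * ‖⟪g, x⟫_ℂ‖ₑ ^ 2 ≤ quadForm T x) :
    ∑' l, (a l : ℝ≥0∞)⁻¹ * (β * ‖⟪g, b l⟫_ℂ‖ₑ ^ 2) ≤ 1 := by
  rw [ENNReal.tsum_eq_iSup_sum]
  refine iSup_le fun s => ?_
  set S : ℝ := ∑ l ∈ s, (a l : ℝ)⁻¹ * ‖⟪g, b l⟫_ℂ‖ ^ 2 with hS
  have hS0 : 0 ≤ S := Finset.sum_nonneg fun l _ => by positivity
  -- A finite truncation of T⁻¹ g. Testing the hypothesis on it gives β S² ≤ S, where S is the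
  -- truncated ⟨T⁻¹ g, g⟩.
  set v : H := ∑ l ∈ s, (((a l : ℝ)⁻¹ : ℂ) * ⟪b l, g⟫_ℂ) • b l with hv
  have h1 : ⟪g, v⟫_ℂ = (S : ℂ) := by
    rw [hv, inner_sum, hS]
    push_cast
    refine Finset.sum_congr rfl fun l _ => ?_
    rw [inner_smul_right, mul_assoc, ← inner_conj_symm (b l) g, Complex.conj_mul']
  have h2 : ⟪T v, v⟫_ℂ = (S : ℂ) := by
    rw [hv, map_sum]
    simp only [map_smul, h _, smul_smul]
    rw [b.orthonormal.inner_sum, hS]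
    push_cast
    refine Finset.sum_congr rfl fun l _ => ?_
    rw [← inner_conj_symm (b l) g]
    simp only [map_mul, map_inv₀, Complex.conj_ofReal, Complex.conj_conj]
    rw [← Complex.mul_conj']
    by_cases h0 : (a l : ℝ) = 0
    · simp [h0]
    · have : ((a l : ℝ) : ℂ) ≠ 0 := by exact_mod_cast h0
      field_simp
  have h3 : (β : ℝ) * S ^ 2 ≤ S := by
    have := hg v
    rw [quadForm, ContinuousLinearMap.reApplyInnerSelf_apply, h1, h2, ← ofReal_norm,
      ← ENNReal.ofReal_pow (norm_nonneg _), ← ENNReal.ofReal_coe_nnreal,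
      ← ENNReal.ofReal_mul (NNReal.coe_nonneg _)] at this
    have := (ENNReal.ofReal_le_ofReal_iff (by simpa using hS0)).1 this
    simpa [abs_of_nonneg hS0] using this
  have h4 : (β : ℝ) * S ≤ 1 := by
    rcases hS0.eq_or_lt with h0 | h0
    · simp [← h0]
    · by_contra hc
      nlinarith
  have h5 : ∑ l ∈ s, (a l : ℝ≥0∞)⁻¹ * (β * ‖⟪g, b l⟫_ℂ‖ₑ ^ 2) = ENNReal.ofReal (β * S) := by
    rw [hS, Finset.mul_sum, ENNReal.ofReal_sum_of_nonneg (fun l _ => by positivity)]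
    refine Finset.sum_congr rfl fun l _ => ?_
    -- Here 0⁻¹ is ∞ in `ℝ≥0∞` but 0 in `ℝ`; the hypothesis at b l makes the other factor 0, so both
    -- terms vanish.
    by_cases h0 : a l = 0
    · have := hg (b l)
      rw [h.quadForm_self, h0] at this
      have h00 : (β : ℝ≥0∞) * ‖⟪g, b l⟫_ℂ‖ₑ ^ 2 = 0 := by simpa using this
      rw [h00]
      simp [h0]
    · rw [mul_left_comm, ENNReal.ofReal_mul (by positivity), ENNReal.ofReal_mul (by positivity),
        ENNReal.ofReal_inv_of_pos (by positivity), ENNReal.ofReal_pow (norm_nonneg _),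
        ofReal_norm, ENNReal.ofReal_coe_nnreal, ENNReal.ofReal_coe_nnreal]
  rw [h5]
  exact ENNReal.ofReal_le_one.2 h4

end IsEigenbasis

/-! ### Trace inequalities for a finite sum of positive operators -/

section Sum

variable {ι : Type*} {n : Type*} [Fintype n] {κ : n → Type*} {T : n → H →L[ℂ] H}
  {g : ∀ i, HilbertBasis (κ i) ℂ H} {β : ∀ i, κ i → ℝ≥0} {e : HilbertBasis ι ℂ H} {α : ι → ℝ≥0}

theorem tsum_rpow_le_card_mul (hT : ∀ i, (T i).IsPositive) (hg : ∀ i, IsEigenbasis (T i) (g i) (β i))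
    (he : IsEigenbasis (∑ i, T i) e α) {q : ℝ} (hq : 1 ≤ q) :
    ∑' l, (α l : ℝ≥0∞) ^ q ≤
      (Fintype.card n : ℝ≥0∞) ^ (q - 1) * ∑ i, ∑' k, (β i k : ℝ≥0∞) ^ q := by
  calc ∑' l, (α l : ℝ≥0∞) ^ q
      ≤ ∑' l, (Fintype.card n : ℝ≥0∞) ^ (q - 1) * ∑ i, quadForm (T i) (e l) ^ q := by
        refine ENNReal.tsum_le_tsum fun l => ?_
        rw [← he.quadForm_self l, quadForm_sum _ hT]
        exact ENNReal.rpow_sum_le_const_mul_sum_rpow _ _ hq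
    _ = (Fintype.card n : ℝ≥0∞) ^ (q - 1) * ∑ i, ∑' l, quadForm (T i) (e l) ^ q := by
        rw [ENNReal.tsum_mul_left, Summable.tsum_finsetSum fun _ _ => ENNReal.summable]
    _ ≤ _ := by
        gcongr with i
        exact (hg i).tsum_quadForm_rpow_le (hT i) e hq

theorem card_mul_le_tsum_rpow (hT : ∀ i, (T i).IsPositive) (hg : ∀ i, IsEigenbasis (T i) (g i) (β i))
    (he : IsEigenbasis (∑ i, T i) e α) {q : ℝ} (hq0 : 0 < q) (hq : q ≤ 1) :
    (Fintype.card n : ℝ≥0∞) ^ (q - 1) * ∑ i, ∑' k, (β i k : ℝ≥0∞) ^ q ≤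
      ∑' l, (α l : ℝ≥0∞) ^ q := by
  calc _ ≤ (Fintype.card n : ℝ≥0∞) ^ (q - 1) * ∑ i, ∑' l, quadForm (T i) (e l) ^ q := by
        gcongr with i
        exact (hg i).le_tsum_quadForm_rpow (hT i) e hq0 hq
    _ = ∑' l, (Fintype.card n : ℝ≥0∞) ^ (q - 1) * ∑ i, quadForm (T i) (e l) ^ q := by
        rw [ENNReal.tsum_mul_left, Summable.tsum_finsetSum fun _ _ => ENNReal.summable]
    _ ≤ _ := by
        refine ENNReal.tsum_le_tsum fun l => ?_
        rw [← he.quadForm_self l, quadForm_sum _ hT]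
        exact ENNReal.card_rpow_mul_sum_rpow_le _ _ hq0 hq

theorem mul_enorm_inner_le_quadForm_sum (hT : ∀ i, (T i).IsPositive)
    (hg : ∀ i, IsEigenbasis (T i) (g i) (β i)) (i : n) (k : κ i) (x : H) :
    (β i k : ℝ≥0∞) * ‖⟪g i k, x⟫_ℂ‖ₑ ^ 2 ≤ quadForm (∑ i, T i) x := by
  rw [quadForm_sum _ hT]
  exact ((hg i).mul_enorm_inner_le_quadForm (hT i) k x).trans
    (Finset.single_le_sum (f := fun i => quadForm (T i) x) (fun _ _ => zero_le) (Finset.mem_univ i))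

theorem tsum_inv_mul_mul_eq (hT : ∀ i, (T i).IsPositive)
    (hg : ∀ i, IsEigenbasis (T i) (g i) (β i)) (he : IsEigenbasis (∑ i, T i) e α)
    (i : n) (k : κ i) :
    ∑' l, (α l : ℝ≥0∞)⁻¹ * (β i k * ‖⟪g i k, e l⟫_ℂ‖ₑ ^ 2) * α l = β i k := by
  have h : ∀ l, (α l : ℝ≥0∞)⁻¹ * (β i k * ‖⟪g i k, e l⟫_ℂ‖ₑ ^ 2) * α l =
      β i k * ‖⟪g i k, e l⟫_ℂ‖ₑ ^ 2 := fun l => by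
    by_cases h0 : α l = 0
    · have := mul_enorm_inner_le_quadForm_sum hT hg i k (e l)
      rw [he.quadForm_self, h0, ENNReal.coe_zero, nonpos_iff_eq_zero] at this
      simp only [this, mul_zero, zero_mul]
    · rw [mul_right_comm, ENNReal.inv_mul_cancel (by simpa using h0) ENNReal.coe_ne_top, one_mul]
  simp only [h]
  rw [ENNReal.tsum_mul_left, e.tsum_enorm_inner_sq', (g i).enorm_eq_one, one_pow, mul_one]

/-- For fixed l the sum of β |⟨g, e_l⟩|² over all i and k is ⟨A e_l, e_l⟩ = α_l with A = ∑ T_i,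
which cancels α_l⁻¹. When α_l = 0 both sides vanish since q > 0. -/
theorem sum_tsum_tsum_inv_mul_rpow (hT : ∀ i, (T i).IsPositive)
    (hg : ∀ i, IsEigenbasis (T i) (g i) (β i)) (he : IsEigenbasis (∑ i, T i) e α)
    {q : ℝ} (hq : 0 < q) :
    ∑ i, ∑' k, ∑' l, (α l : ℝ≥0∞)⁻¹ * (β i k * ‖⟪g i k, e l⟫_ℂ‖ₑ ^ 2) * (α l : ℝ≥0∞) ^ q =
      ∑' l, (α l : ℝ≥0∞) ^ q := by
  have hcomm := fun i => ENNReal.tsum_comm (f := fun (k : κ i) l =>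
    (α l : ℝ≥0∞)⁻¹ * (β i k * ‖⟪g i k, e l⟫_ℂ‖ₑ ^ 2) * (α l : ℝ≥0∞) ^ q)
  rw [Finset.sum_congr rfl fun i _ => hcomm i,
    ← Summable.tsum_finsetSum fun _ _ => ENNReal.summable]
  refine tsum_congr fun l => ?_
  simp only [ENNReal.tsum_mul_right, ENNReal.tsum_mul_left, ← Finset.sum_mul, ← Finset.mul_sum,
    ← (hg _).quadForm_eq (hT _), ← quadForm_sum _ hT, he.quadForm_self]
  by_cases h0 : α l = 0
  · simp [h0, hq]
  · rw [ENNReal.inv_mul_cancel (by simpa using h0) ENNReal.coe_ne_top, one_mul]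

theorem sum_tsum_rpow_le (hT : ∀ i, (T i).IsPositive) (hg : ∀ i, IsEigenbasis (T i) (g i) (β i))
    (he : IsEigenbasis (∑ i, T i) e α) {q : ℝ} (hq : 1 ≤ q) :
    ∑ i, ∑' k, (β i k : ℝ≥0∞) ^ q ≤ ∑' l, (α l : ℝ≥0∞) ^ q := by
  rw [← sum_tsum_tsum_inv_mul_rpow hT hg he (by linarith)]
  refine Finset.sum_le_sum fun i _ => ENNReal.tsum_le_tsum fun k => ?_
  conv_lhs => rw [← tsum_inv_mul_mul_eq hT hg he i k]
  exact ENNReal.rpow_tsum_mul_le hq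
    (he.tsum_inv_mul_le_one _ _ (mul_enorm_inner_le_quadForm_sum hT hg i k))

theorem le_sum_tsum_rpow (hT : ∀ i, (T i).IsPositive) (hg : ∀ i, IsEigenbasis (T i) (g i) (β i))
    (he : IsEigenbasis (∑ i, T i) e α) {q : ℝ} (hq0 : 0 < q)
    (hq : q ≤ 1) :
    ∑' l, (α l : ℝ≥0∞) ^ q ≤ ∑ i, ∑' k, (β i k : ℝ≥0∞) ^ q := by
  rw [← sum_tsum_tsum_inv_mul_rpow hT hg he hq0]
  refine Finset.sum_le_sum fun i _ => ENNReal.tsum_le_tsum fun k => ?_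
  conv_rhs => rw [← tsum_inv_mul_mul_eq hT hg he i k]
  exact ENNReal.tsum_mul_rpow_le hq0 hq
    (he.tsum_inv_mul_le_one _ _ (mul_enorm_inner_le_quadForm_sum hT hg i k))

end Sum

end Eigenbasis

/-! ### Spectral theorem and Schatten norms as eigenvalue sums -/

section Spectral

universe u

variable {H : Type u} [NormedAddCommGroup H] [InnerProductSpace ℂ H] [CompleteSpace H]

/-- An eigenvector for c is orthogonal to each b l with a l ≠ c, so the remaining b l form a basis
of the eigenspace. Compactness and c ≠ 0 make it finite-dimensional, so `finrank` is not its default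
value 0. -/
theorem IsEigenbasis.finrank_eigenspace {ι : Type*} {T : H →L[ℂ] H} {b : HilbertBasis ι ℂ H}
    {a : ι → ℝ≥0} (h : IsEigenbasis T b a) (hc : IsCompactOperator T) (hT : T.IsPositive)
    {c : ℝ≥0} (hc0 : c ≠ 0) :
    (Module.finrank ℂ (eigenspace (T : H →ₗ[ℂ] H) ((c : ℝ) : ℂ)) : ℝ≥0∞) =
      (ENat.card (a ⁻¹' {c}) : ℝ≥0∞) := by
  have : FiniteDimensional ℂ (eigenspace (T : H →ₗ[ℂ] H) ((c : ℝ) : ℂ)) :=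
    ContinuousLinearMap.finite_dimensional_eigenspace hc _ (by simpa using hc0)
  let v : a ⁻¹' {c} → eigenspace (T : H →ₗ[ℂ] H) ((c : ℝ) : ℂ) := fun l =>
    ⟨b l, by
      have hl : a l = c := l.2
      rw [mem_eigenspace_iff]
      simpa only [hl] using! h l⟩
  have hv : Orthonormal ℂ v := by
    have := b.orthonormal.comp _ (Subtype.val_injective (p := (· ∈ a ⁻¹' {c})))
    exact ⟨fun l => this.1 l, fun i j hij => this.2 hij⟩
  have : Finite (a ⁻¹' {c}) := hv.linearIndependent.finite
  have := Fintype.ofFinite (a ⁻¹' {c})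
  have hbot : (Submodule.span ℂ (Set.range v))ᗮ = ⊥ := by
    rw [Submodule.eq_bot_iff]
    intro x hx
    have hx2 := mem_eigenspace_iff.1 x.2
    have key : ∀ l, ⟪b l, (x : H)⟫_ℂ = 0 := fun l => by
      by_cases hl : a l = c
      · have : ⟪v ⟨l, hl⟩, x⟫_ℂ = 0 := Submodule.inner_right_of_mem_orthogonal
          (Submodule.subset_span (Set.mem_range_self _)) hx
        exact this
      · have h1 := h.inner_apply hT l x
        have h2 : T (x : H) = ((c : ℝ) : ℂ) • (x : H) := hx2
        rw [h2, inner_smul_right] at h1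
        have h3 : ((c : ℝ) : ℂ) ≠ ((a l : ℝ) : ℂ) := by
          simpa using fun h => hl h.symm
        by_contra h4
        exact h3 (mul_right_cancel₀ h4 h1)
    have hz := b.hasSum_repr (x : H)
    simp only [b.repr_apply_apply, key, zero_smul] at hz
    exact Subtype.ext (hz.unique hasSum_zero)
  rw [Module.finrank_eq_card_basis (OrthonormalBasis.mkOfOrthogonalEqBot hv hbot).toBasis,
    ENat.card_eq_coe_fintype_card, ENat.toENNReal_coe]

/-- The spectral theorem for compact positive operators, in terms of Hilbert bases. -/
theorem exists_isEigenbasis {T : H →L[ℂ] H} (hc : IsCompactOperator T) (hT : T.IsPositive) :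
    ∃ (ι : Type u) (b : HilbertBasis ι ℂ H) (a : ι → ℝ≥0), IsEigenbasis T b a := by
  have hclosed : ∀ μ : ℂ, IsClosed (eigenspace (T : H →ₗ[ℂ] H) μ : Set H) := fun μ => by
    have : (eigenspace (T : H →ₗ[ℂ] H) μ : Set H) = {x | T x = μ • x} := by
      ext x
      simp
    rw [this]
    exact isClosed_eq T.continuous (continuous_const_smul μ)
  have hcomp : ∀ μ : ℂ, CompleteSpace (eigenspace (T : H →ₗ[ℂ] H) μ) := fun μ =>
    (hclosed μ).completeSpace_coe
  choose w c hcw using fun μ : ℂ => exists_hilbertBasis ℂ (eigenspace (T : H →ₗ[ℂ] H) μ)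
  have hon : Orthonormal ℂ (fun x : Σ μ, w μ => ((c x.1 x.2 : eigenspace (T : H →ₗ[ℂ] H) x.1) : H)) :=
    hT.isSymmetric.orthogonalFamily_eigenspaces.orthonormal_sigma_orthonormal
      fun μ => (c μ).orthonormal
  have hbot : (Submodule.span ℂ (Set.range fun x : Σ μ, w μ =>
      ((c x.1 x.2 : eigenspace (T : H →ₗ[ℂ] H) x.1) : H)))ᗮ = ⊥ := by
    rw [eq_bot_iff, ← ContinuousLinearMap.orthogonalComplement_iSup_eigenspaces_eq_bot hc
      hT.isSymmetric, ← Submodule.iInf_orthogonal, le_iInf_iff]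
    intro μ x hx
    rw [Submodule.mem_orthogonal']
    intro y hy
    have hs := ((c μ).hasSum_repr ⟨y, hy⟩).mapL (Submodule.subtypeL _)
    have hs2 := hs.mapL (innerSL ℂ x)
    refine hs2.unique ?_
    convert hasSum_zero with l
    have : ⟪x, ((c μ l : eigenspace (T : H →ₗ[ℂ] H) μ) : H)⟫_ℂ = 0 :=
      Submodule.inner_left_of_mem_orthogonal (Submodule.subset_span
        (Set.mem_range_self (f := fun x : Σ μ, w μ =>
          ((c x.1 x.2 : eigenspace (T : H →ₗ[ℂ] H) x.1) : H)) ⟨μ, l⟩)) hx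
    simp [this]
  let b := HilbertBasis.mkOfOrthogonalEqBot hon hbot
  have hb : ∀ l, T (b l) = l.1 • b l := fun l => by
    simp only [b, HilbertBasis.coe_mkOfOrthogonalEqBot]
    exact mem_eigenspace_iff.1 (c l.1 l.2).2
  have hμ : ∀ l : Σ μ, w μ, 0 ≤ (l.1 : ℂ) := fun l => by
    have := hT.inner_nonneg_right (b l)
    rw [hb l, inner_smul_right, inner_self_eq_norm_sq_to_K, b.orthonormal.1 l] at this
    simpa using this
  refine ⟨_, b, fun l => ⟨l.1.re, (Complex.nonneg_iff.1 (hμ l)).1⟩, fun l => ?_⟩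
  rw [hb l]
  congr 1
  exact Complex.ext rfl (by simpa using (Complex.nonneg_iff.1 (hμ l)).2.symm)

theorem eSchattenNorm_rpow_eq_tsum {X : H →L[ℂ] H} (hX : IsCompactOperator X) {p : ℝ} (hp : 0 < p)
    {ι : Type*} {b : HilbertBasis ι ℂ H} {a : ι → ℝ≥0}
    (h : IsEigenbasis (ContinuousLinearMap.adjoint X * X) b a) :
    eSchattenNorm p X ^ p = ∑' l, (a l : ℝ≥0∞) ^ (p / 2) := by
  have hc : IsCompactOperator (ContinuousLinearMap.adjoint X * X : H →L[ℂ] H) :=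
    hX.clm_comp (ContinuousLinearMap.adjoint X)
  have hT : (ContinuousLinearMap.adjoint X * X : H →L[ℂ] H).IsPositive :=
    ContinuousLinearMap.isPositive_adjoint_comp_self X
  have hp2 : 0 < p / 2 := by positivity
  rw [eSchattenNorm, ← ENNReal.rpow_mul, one_div_mul_cancel hp.ne', ENNReal.rpow_one,
    ← ENNReal.tsum_fiberwise _ a]
  have hfib : ∀ c : ℝ≥0, ∑' l : a ⁻¹' {c}, (a l : ℝ≥0∞) ^ (p / 2) =
      (ENat.card (a ⁻¹' {c}) : ℝ≥0∞) * (c : ℝ≥0∞) ^ (p / 2) := fun c => by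
    rw [← ENNReal.tsum_const]
    refine tsum_congr fun l => ?_
    rw [show a l = c from l.2]
  simp only [hfib]
  -- Singular values to eigenvalues, σ ↦ σ². Only c = 0 is missed, and its term is 0.
  let φ : Set.Ioi (0 : ℝ) → ℝ≥0 := fun σ => ⟨σ, le_of_lt σ.2⟩ ^ 2
  have hφ : Function.Injective φ := fun σ τ hst => by
    have h1 : (σ : ℝ) ^ 2 = (τ : ℝ) ^ 2 := congrArg NNReal.toReal hst
    exact Subtype.ext ((sq_eq_sq₀ (le_of_lt σ.2) (le_of_lt τ.2)).1 h1)
  rw [← hφ.tsum_eq (f := fun c : ℝ≥0 => (ENat.card (a ⁻¹' {c}) : ℝ≥0∞) * (c : ℝ≥0∞) ^ (p / 2))]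
  · refine tsum_congr fun σ => ?_
    have hσ : (0 : ℝ) < σ := σ.2
    have h0 : φ σ ≠ 0 := fun h => by
      have : (σ : ℝ) ^ 2 = 0 := congrArg NNReal.toReal h
      exact hσ.ne' (pow_eq_zero_iff two_ne_zero |>.1 this)
    rw [← h.finrank_eigenspace hc hT h0, singularMultiplicity]
    congr 1
    have : (φ σ : ℝ≥0∞) = ENNReal.ofReal σ ^ (2 : ℝ) := by
      rw [ENNReal.rpow_two, ← ENNReal.ofReal_pow hσ.le, ← ENNReal.ofReal_coe_nnreal]
      rfl
    rw [this, ← ENNReal.rpow_mul]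
    congr 1
    ring
  · intro c hc
    have hc0 : c ≠ 0 := by
      rintro rfl
      simp [hp2] at hc
    refine ⟨⟨Real.sqrt c, Real.sqrt_pos.2 (by positivity)⟩, ?_⟩
    exact NNReal.eq (Real.sq_sqrt c.2)

/-- The trace inequalities comparing `∑ i, ‖X i‖ₚᵖ` with `Tr (∑ i, |X i|²)^(p/2)`. -/
theorem sum_eSchattenNorm_rpow_bounds {n : Type*} [Fintype n] {p : ℝ} (hp : 0 < p)
    {X : n → H →L[ℂ] H} (hX : ∀ i, IsCompactOperator (X i)) {ι : Type*} {e : HilbertBasis ι ℂ H}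
    {α : ι → ℝ≥0} (he : IsEigenbasis (∑ i, ContinuousLinearMap.adjoint (X i) * X i) e α) :
    (2 ≤ p → ∑ i, eSchattenNorm p (X i) ^ p ≤ ∑' l, (α l : ℝ≥0∞) ^ (p / 2) ∧
      ∑' l, (α l : ℝ≥0∞) ^ (p / 2) ≤
        (Fintype.card n : ℝ≥0∞) ^ (p / 2 - 1) * ∑ i, eSchattenNorm p (X i) ^ p) ∧
    (p ≤ 2 → ∑' l, (α l : ℝ≥0∞) ^ (p / 2) ≤ ∑ i, eSchattenNorm p (X i) ^ p ∧
      (Fintype.card n : ℝ≥0∞) ^ (p / 2 - 1) * ∑ i, eSchattenNorm p (X i) ^ p ≤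
        ∑' l, (α l : ℝ≥0∞) ^ (p / 2)) := by
  have hT : ∀ i, (ContinuousLinearMap.adjoint (X i) * X i : H →L[ℂ] H).IsPositive := fun i =>
    ContinuousLinearMap.isPositive_adjoint_comp_self (X i)
  choose κ g β hg using fun i => exists_isEigenbasis
    ((hX i).clm_comp (ContinuousLinearMap.adjoint (X i))) (hT i)
  rw [Finset.sum_congr rfl fun i _ => eSchattenNorm_rpow_eq_tsum (hX i) hp (hg i)]
  refine ⟨fun h => ⟨?_, ?_⟩, fun h => ⟨?_, ?_⟩⟩
  · exact sum_tsum_rpow_le hT hg he (by linarith)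
  · exact tsum_rpow_le_card_mul hT hg he (by linarith)
  · exact le_sum_tsum_rpow hT hg he (by linarith) (by linarith)
  · exact card_mul_le_tsum_rpow hT hg he (by linarith) (by linarith)

theorem exists_isEigenbasis_sum_adjoint_mul {n : Type*} [Fintype n] {X : n → H →L[ℂ] H}
    (hX : ∀ i, IsCompactOperator (X i)) :
    ∃ (ι : Type u) (e : HilbertBasis ι ℂ H) (α : ι → ℝ≥0),
      IsEigenbasis (∑ i, ContinuousLinearMap.adjoint (X i) * X i) e α := by
  refine exists_isEigenbasis ?_ (ContinuousLinearMap.isPositive_sum _ fun i _ =>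
    ContinuousLinearMap.isPositive_adjoint_comp_self (X i))
  exact Submodule.sum_mem (compactOperator (RingHom.id ℂ) H H) fun i _ =>
    (hX i).clm_comp (ContinuousLinearMap.adjoint (X i))

theorem toReal_sum_eSchattenNorm_rpow {n : Type*} [Fintype n] {p : ℝ} (hp : 0 < p)
    {X : n → H →L[ℂ] H} (hX : ∀ i, MemSchatten p (X i)) :
    ∑ i, eSchattenNorm p (X i) ^ p ≠ ∞ ∧
      (∑ i, eSchattenNorm p (X i) ^ p).toReal = ∑ i, schattenNorm p (X i) ^ p := by
  have h : ∀ i, eSchattenNorm p (X i) ^ p ≠ ∞ := fun i =>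
    ENNReal.rpow_ne_top_of_nonneg hp.le (hX i).eSchattenNorm_lt_top.ne
  refine ⟨ENNReal.sum_ne_top.2 fun i _ => h i, ?_⟩
  rw [ENNReal.toReal_sum fun i _ => h i]
  simp only [← ENNReal.toReal_rpow, schattenNorm]

end Spectral

/-! ### Comparison of the two families through the common sum -/

theorem corollary1p8 {H : Type*} [NormedAddCommGroup H] [InnerProductSpace ℂ H]
    [CompleteSpace H] (p : ℝ) (hp : 0 < p) (s t : ℕ) (hs : 1 ≤ s) (ht : 1 ≤ t)
    (X : Fin s → H →L[ℂ] H) (Y : Fin t → H →L[ℂ] H)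
    (hX : ∀ i, MemSchatten p (X i)) (hY : ∀ j, MemSchatten p (Y j))
    (hXY : ∑ i, CFC.abs (X i) ^ 2 = ∑ j, CFC.abs (Y j) ^ 2) :
    (2 ≤ p →
      (s : ℝ) ^ (1 - p / 2) * ∑ j, schattenNorm p (Y j) ^ p ≤ ∑ i, schattenNorm p (X i) ^ p ∧
      ∑ i, schattenNorm p (X i) ^ p ≤ (t : ℝ) ^ (p / 2 - 1) * ∑ j, schattenNorm p (Y j) ^ p) ∧
    (p ≤ 2 →
      (t : ℝ) ^ (p / 2 - 1) * ∑ j, schattenNorm p (Y j) ^ p ≤ ∑ i, schattenNorm p (X i) ^ p ∧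
      ∑ i, schattenNorm p (X i) ^ p ≤ (s : ℝ) ^ (1 - p / 2) * ∑ j, schattenNorm p (Y j) ^ p) := by
  simp only [CFC.abs_sq, ContinuousLinearMap.star_eq_adjoint] at hXY
  obtain ⟨ι, e, α, he⟩ := exists_isEigenbasis_sum_adjoint_mul fun i => (hX i).isCompactOperator
  have bX := sum_eSchattenNorm_rpow_bounds hp (fun i => (hX i).isCompactOperator) he
  have bY := sum_eSchattenNorm_rpow_bounds hp (fun j => (hY j).isCompactOperator) (hXY ▸ he)
  obtain ⟨fX, rX⟩ := toReal_sum_eSchattenNorm_rpow hp hX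
  obtain ⟨fY, rY⟩ := toReal_sum_eSchattenNorm_rpow hp hY
  have hcard : ∀ m : ℕ, 1 ≤ m → ∀ r : ℝ, (m : ℝ≥0∞) ^ r ≠ ∞ := fun m hm r =>
    ENNReal.rpow_ne_top_of_ne_zero (by simp; omega) (ENNReal.natCast_ne_top m)
  have upper : ∀ {m : ℕ} {r : ℝ} {a b : ℝ≥0∞}, 1 ≤ m → b ≠ ∞ → a ≤ (m : ℝ≥0∞) ^ r * b →
      a.toReal ≤ (m : ℝ) ^ r * b.toReal := fun {m r a b} hm hb hab => by
    simpa [ENNReal.toReal_mul, ← ENNReal.toReal_rpow] using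
      ENNReal.toReal_mono (ENNReal.mul_ne_top (hcard m hm r) hb) hab
  have lower : ∀ {m : ℕ} {r : ℝ} {a b : ℝ≥0∞}, a ≠ ∞ → (m : ℝ≥0∞) ^ r * b ≤ a →
      (m : ℝ) ^ r * b.toReal ≤ a.toReal := fun {m r a b} ha hab => by
    simpa [ENNReal.toReal_mul, ← ENNReal.toReal_rpow] using ENNReal.toReal_mono ha hab
  have hs0 : (0 : ℝ) < s := by exact_mod_cast hs
  have hinv : (s : ℝ) ^ (1 - p / 2) * (s : ℝ) ^ (p / 2 - 1) = 1 := by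
    rw [← Real.rpow_add hs0]
    simp
  have hpos : (0 : ℝ) ≤ (s : ℝ) ^ (1 - p / 2) := by positivity
  simp only [Fintype.card_fin] at bX bY
  rw [← rX, ← rY]
  refine ⟨fun h => ⟨?_, ?_⟩, fun h => ⟨?_, ?_⟩⟩
  -- The chain puts s^(p/2-1) on the X side; multiplying by its inverse moves it to the Y side.
  · have := mul_le_mul_of_nonneg_left (upper hs fX (((bY.1 h).1).trans (bX.1 h).2)) hpos
    rwa [← mul_assoc, hinv, one_mul] at this
  · exact upper ht fY ((bX.1 h).1.trans (bY.1 h).2)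
  · exact lower fX ((bY.2 h).2.trans (bX.2 h).1)
  · have := mul_le_mul_of_nonneg_left (lower fY (((bX.2 h).2).trans (bY.2 h).1)) hpos
    rwa [← mul_assoc, hinv, one_mul] at this
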